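/- Let $\mathbb{R}^\infty=\bigcup_{i\ge 1}\mathbb{R}^i$, $\mathbb{Z}^\infty=\bigcup_{i\ge 1}\mathbb{Z}^i$, and $\mathbb{N}=\{0,1,2,\dots\}\subseteq\mathbb{R}=\mathbb{R}^1\subseteq\mathbb{R}^\infty$. An additive machine without irrational constants has real registers $Z_1,Z_2,\dots$ and index registers $I_1,I_2,\dots,I_k$ holding positive integers. Its program is a finite list of labelled instructions of the forms $Z_i:=Z_j+Z_k$; $Z_i:=Z_j-Z_k$; $Z_j:=c$ with $c\in\{0,1\}$; $Z_{I_j}:=Z_{I_k}$; $I_j:=1$; $I_j:=I_j+1$; "if $I_j=I_k$ then goto $l_1$ else goto $l_2$"; and, in addition, - for the class $\mathsf{M}_{\rm add}^{1,=}$: equality tests "if $Z_j=0$ then goto $l_1$ else goto $l_2$"; - for the class $\mathsf{M}_{\rm add}^{1}$: order tests "if $Z_j\ge 0$ then goto $l_1$ else goto $l_2$"; - for the class $\mathsf{M}_{\rm add}^{1}(\mathcal{O})$, where $\mathcal{O}\subseteq\mathbb{R}^\infty$: the order tests and the oracle queries "if $(Z_1,\dots,Z_{I_1})\in\mathcal{O}$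 then goto $l_1$ else goto $l_2$". On input $(x_1,\dots,x_n)\in\mathbb{R}^\infty$ a machine starts with $Z_1=x_1,\dots,Z_n=x_n$, $0$ in all other real registers, and $n$ in all index registers; if it halts, its output is $(Z_1,\dots,Z_{I_1})$. A set $S\subseteq\mathbb{R}^\infty$ is decided by a machine if the machine computes the characteristic function of $S$ on $\mathbb{R}^\infty$ (output $1$ on $S$ and $0$ on $\mathbb{R}^\infty\setminus S$), and it is semi-decided by a machine if the machine computes the partial characteristic function of $S$ (output $1$ on $S$, no halting on $\mathbb{R}^\infty\setminus S$). It is called $\mathsf{M}$-decidable, or $\mathsf{M}$-semi-decidable, if some machine in $\mathsf{M}$ does so. A set $\mathcal{A}\subseteq\mathbb{R}^\infty$ is strongly Turing reducible to $\mathcal{B}\subseteq\mathbb{R}^\infty$, written $\mathcal{A}\preceq\mathcal{B}$, if $\mathcal{A}$ is decided by a machine in $\mathsf{M}_{\rm add}^{1}(\mathcal{B})$. **Proposition.** Let $\mathcal{Q}\subseteq\mathbb{R}^\infty$ be $\mathsf{M}_{\rm add}^{1}$-decidable for all inputs in $\mathbb{Z}^\infty$, that is, let $\mathcal{Q}\cap\mathbb{Z}^\infty$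 be $\mathsf{M}_{\rm add}^{1}$-decidable, and let $P\subseteq\mathbb{N}$. If $P$ is not $\mathsf{M}_{\rm add}^{1,=}$-semi-decidable or $(\mathbb{R}^\infty\setminus P)\cap\mathbb{N}$ is not $\mathsf{M}_{\rm add}^{1,=}$-semi-decidable, then $P\not\preceq\mathcal{Q}$. -/

import Mathlib

/-!
# Additive BSS random access machines over the real numbers

Real registers `Z_1, Z_2, …` and index registers `I_1, I_2, …` are numbered by positive integers,
and index registers hold positive integers.
-/

namespace AddBSS

/-- `ℝ^∞ = ⋃_{i ≥ 1} ℝ^i`, the set of all nonempty finite tuples of real numbers. -/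
def RInf : Set (List ℝ) := {x | x ≠ []}

/-- `ℤ^∞`, the set of all nonempty finite tuples of integers, as a subset of `ℝ^∞`. -/
def ZInf : Set (List ℝ) := {x | x ∈ RInf ∧ ∀ a ∈ x, ∃ m : ℤ, a = (m : ℝ)}

/-- `ℕ = {0, 1, …}` as a subset of `ℝ = ℝ^1 ⊆ ℝ^∞`. -/
def NatSet : Set (List ℝ) := {x | ∃ n : ℕ, x = [(n : ℝ)]}

/-- The instructions of additive (oracle) machines. Labels are natural numbers. -/
inductive Instr : Type
  /-- `Z_i := Z_j + Z_k` -/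
  | add (i j k : ℕ+)
  /-- `Z_i := Z_j - Z_k` -/
  | sub (i j k : ℕ+)
  /-- `Z_j := c` -/
  | const (j : ℕ+) (c : ℝ)
  /-- `if Z_j = 0 then goto l₁ else goto l₂` -/
  | ifZero (j : ℕ+) (l₁ l₂ : ℕ)
  /-- `if Z_j ≥ 0 then goto l₁ else goto l₂` -/
  | ifNonneg (j : ℕ+) (l₁ l₂ : ℕ)
  /-- `Z_{I_j} := Z_{I_k}` -/
  | copy (j k : ℕ+)
  /-- `I_j := 1` -/
  | indexOne (j : ℕ+)
  /-- `I_j := I_j + 1` -/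
  | indexSucc (j : ℕ+)
  /-- `if I_j = I_k then goto l₁ else goto l₂` -/
  | ifIndexEq (j k : ℕ+) (l₁ l₂ : ℕ)
  /-- `if (Z_1, …, Z_{I_1}) ∈ O then goto l₁ else goto l₂` -/
  | ifOracle (l₁ l₂ : ℕ)

/-- A program: a finite list of instructions, labelled `0, 1, 2, …` in order. The computation
starts at label `0`, and it stops when it reaches a label that carries no instruction.
A program mentions only finitely many index registers; those that it does not mention (other than
`I_1`, which is also used for output and for queries) have no influence on the computation. -/
abbrev Program : Type := List Instr

/-- The current label and the contents of the registers. -/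
structure Config : Type where
  label : ℕ
  Z : ℕ+ → ℝ
  I : ℕ+ → ℕ+

/-- The tuple `(Z_1, …, Z_{I_1})`. -/
def Config.tuple (c : Config) : List ℝ :=
  (List.range (c.I 1 : ℕ)).map fun i => c.Z i.succPNat

/-- Input procedure: `Z_1 := x_1; …; Z_n := x_n; I_1 := n; I_2 := n; …`. The other real registers
contain `0`. -/
def init (x : List ℝ) : Config where
  label := 0
  Z := fun i => x.getD i.natPred 0
  I := fun _ => x.length.toPNat'

open Classical in
/-- The effect of one instruction, with oracle set `O`. -/
noncomputable def Instr.exec (O : Set (List ℝ)) (c : Config) : Instr → Config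
  | .add i j k =>
      { c with label := c.label + 1, Z := Function.update c.Z i (c.Z j + c.Z k) }
  | .sub i j k =>
      { c with label := c.label + 1, Z := Function.update c.Z i (c.Z j - c.Z k) }
  | .const j a => { c with label := c.label + 1, Z := Function.update c.Z j a }
  | .ifZero j l₁ l₂ => { c with label := if c.Z j = 0 then l₁ else l₂ }
  | .ifNonneg j l₁ l₂ => { c with label := if c.Z j ≥ 0 then l₁ else l₂ }
  | .copy j k =>
      { c with label := c.label + 1, Z := Function.update c.Z (c.I j) (c.Z (c.I k)) }
  | .indexOne j => { c with label := c.label + 1, I := Function.update c.I j 1 }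
  | .indexSucc j => { c with label := c.label + 1, I := Function.update c.I j (c.I j + 1) }
  | .ifIndexEq j k l₁ l₂ => { c with label := if c.I j = c.I k then l₁ else l₂ }
  | .ifOracle l₁ l₂ => { c with label := if c.tuple ∈ O then l₁ else l₂ }

/-- One step of the machine with program `M` and oracle set `O`; `none` if it has stopped. -/
noncomputable def step (O : Set (List ℝ)) (M : Program) (c : Config) : Option Config :=
  M[c.label]?.map (Instr.exec O c)

/-- The partial function computed by the machine with program `M` and oracle set `O`: its value
at `x` is the content `(Z_1, …, Z_{I_1})` of the registers when `M` has stopped on input `x`, and it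
is undefined if `M` does not stop on `x`. -/
noncomputable def result (O : Set (List ℝ)) (M : Program) (x : List ℝ) : Part (List ℝ) :=
  (StateTransition.eval (step O M) (init x)).map Config.tuple

/-- The instructions of machines over `(ℝ; 0, 1; +, -; =)` without oracle. -/
def Instr.IsAddOneEq : Instr → Prop
  | .const _ c => c = 0 ∨ c = 1
  | .ifNonneg _ _ _ => False
  | .ifOracle _ _ => False
  | _ => True

/-- The instructions of oracle machines over `(ℝ; 0, 1; +, -; ≥)`. -/
def Instr.IsAddOneOracle : Instr → Prop
  | .const _ c => c = 0 ∨ c = 1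
  | .ifZero _ _ _ => False
  | _ => True

/-- The instructions of machines over `(ℝ; 0, 1; +, -; ≥)` without oracle. -/
def Instr.IsAddOne : Instr → Prop
  | .ifOracle _ _ => False
  | i => i.IsAddOneOracle

/-- The class `M_add^{1,=}`. -/
def MAddOneEq : Set Program := {M | ∀ i ∈ M, i.IsAddOneEq}

/-- The class `M_add^1`. -/
def MAddOne : Set Program := {M | ∀ i ∈ M, i.IsAddOne}

/-- The programs of the machines in the classes `M_add^1(O)`; the oracle set `O` itself enters when
the program is run. -/
def MAddOneOracle : Set Program := {M | ∀ i ∈ M, i.IsAddOneOracle}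

/-- The characteristic function of `P ⊆ ℝ^∞`, with values in `{0, 1} ⊆ ℝ^1`. -/
noncomputable def charFun (P : Set (List ℝ)) (x : List ℝ) : List ℝ :=
  [P.indicator (fun _ => (1 : ℝ)) x]

/-- The partial characteristic function of `P ⊆ ℝ^∞`: `1` on `P` and undefined elsewhere. -/
def partialCharFun (P : Set (List ℝ)) (x : List ℝ) : Part (List ℝ) :=
  ⟨x ∈ P, fun _ => [1]⟩

/-- The machine with program `M` and oracle set `O` decides `P ⊆ ℝ^∞`. -/
def Decides (O : Set (List ℝ)) (M : Program) (P : Set (List ℝ)) : Prop :=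
  ∀ x ∈ RInf, result O M x = Part.some (charFun P x)

/-- The machine with program `M` and oracle set `O` semi-decides `P ⊆ ℝ^∞`. -/
def SemiDecides (O : Set (List ℝ)) (M : Program) (P : Set (List ℝ)) : Prop :=
  ∀ x ∈ RInf, result O M x = partialCharFun P x

/-- `P` is `M_add^1`-decidable. (No machine in this class can query the oracle.) -/
def AddOneDecidable (P : Set (List ℝ)) : Prop :=
  ∃ M ∈ MAddOne, Decides ∅ M P

/-- `P` is `M_add^{1,=}`-semi-decidable. (No machine in this class can query the oracle.) -/
def AddOneEqSemiDecidable (P : Set (List ℝ)) : Prop :=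
  ∃ M ∈ MAddOneEq, SemiDecides ∅ M P

/-- `Q` is `M_add^1`-decidable for all inputs in `ℤ^∞`. -/
def AddOneDecidableOnIntegers (Q : Set (List ℝ)) : Prop :=
  AddOneDecidable (Q ∩ ZInf)

/-- Strong Turing reducibility `A ≼ B`: some machine in `M_add^1(B)` decides `A`. -/
def StrongTuringReducible (A B : Set (List ℝ)) : Prop :=
  ∃ M ∈ MAddOneOracle, Decides B M A

end AddBSS

/-! The proof is by contraposition and passes through classical computability. A machine over `0, 1,
+, -` that starts on integers only ever holds integers, so every oracle query on a natural input is
an integer tuple, and on such tuples `Q` agrees with `Q ∩ ZInf`. Integer configurations are finite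
objects, and a step on them is computable once the answers to queries are. Hence
`exists_computable_of_decides` applies twice: to the decider of `Q ∩ ZInf`, giving a computable
oracle on integer tuples, and then to the reduction of `P`, showing that the naturals in `P` form a
computable set.

Conversely, every computable set of naturals is semi-decided with equality tests alone
(`addOneEqSemiDecidable_of_computablePred`). Counting up from `0` until the input is met recognises
the naturals, and diverges elsewhere. Afterwards zero tests, increments and decrements suffice for
while-programs, which compute all computable functions (`exists_cmd_of_computable`). Computability
passes to the complement in the naturals, so both sets in the theorem would be semi-decidable.

Integers are coded as differences of pairs of naturals: addition and subtraction become
componentwise sums, and sign tests become comparisons. -/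

namespace AddBSS

/-! ### Finitely supported register contents -/

/-- The register contents given by a list of values and a default value. -/
abbrev Store (α : Type) : Type := List α × α

namespace Store

variable {α : Type}

/-- The content of register `i`. -/
def get (s : Store α) (i : ℕ) : α := s.1[i]?.getD s.2

/-- Writing `a` into register `i`. -/
def set (s : Store α) (i : ℕ) (a : α) : Store α :=
  ((List.range (max s.1.length (i + 1))).map fun k => bif k == i then a else s.get k, s.2)

theorem get_set (s : Store α) (i k : ℕ) (a : α) :
    (s.set i a).get k = if k = i then a else s.get k := by
  by_cases hk : k < max s.1.length (i + 1)
  · have h : (List.range (max s.1.length (i + 1)))[k]? = some k := by simp [hk]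
    rw [get, set, List.getElem?_map, h]
    by_cases hki : k = i
    · simp [hki]
    · simp [hki, beq_false_of_ne hki, get]
  · have h1 : s.1.length ≤ k := by omega
    have h2 : k ≠ i := by omega
    have h3 : (List.range (max s.1.length (i + 1)))[k]? = none := by simp; omega
    simp [get, set, List.getElem?_map, h3, h2, h1]

variable [Primcodable α]

theorem primrec_get : Primrec₂ (get : Store α → ℕ → α) :=
  Primrec.option_getD.comp
    (Primrec.list_getElem?.comp (Primrec.fst.comp Primrec.fst) Primrec.snd)
    (Primrec.snd.comp Primrec.fst)

theorem primrec_set : Primrec fun p : Store α × ℕ × α => p.1.set p.2.1 p.2.2 := by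
  have h : Primrec₂ fun (p : Store α × ℕ × α) (k : ℕ) =>
      bif k == p.2.1 then p.2.2 else p.1.get k :=
    Primrec.cond
      (Primrec.beq.comp Primrec.snd (Primrec.fst.comp (Primrec.snd.comp Primrec.fst)))
      (Primrec.snd.comp (Primrec.snd.comp Primrec.fst))
      (primrec_get.comp (Primrec.fst.comp Primrec.fst) Primrec.snd)
  exact Primrec.pair (Primrec.list_map (Primrec.list_range.comp
    (Primrec.nat_max.comp (Primrec.list_length.comp (Primrec.fst.comp Primrec.fst))
      (Primrec.succ.comp (Primrec.fst.comp Primrec.snd)))) h)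
    (Primrec.snd.comp Primrec.fst)

theorem computable_get {β : Type} [Primcodable β] {s : β → Store α} {i : β → ℕ}
    (hs : Computable s) (hi : Computable i) : Computable fun b => (s b).get (i b) :=
  primrec_get.to_comp.comp hs hi

theorem computable_set {β : Type} [Primcodable β] {s : β → Store α} {i : β → ℕ} {a : β → α}
    (hs : Computable s) (hi : Computable i) (ha : Computable a) :
    Computable fun b => (s b).set (i b) (a b) :=
  primrec_set.to_comp.comp (hs.pair (hi.pair ha))

end Store

/-! ### Simulation of additive machines on integer inputs -/

/-- The integer `a - b` represented by the pair `(a, b)`, as a real number. -/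
def diff (p : ℕ × ℕ) : ℝ := (p.1 : ℝ) - p.2

theorem diff_eq_zero (p : ℕ × ℕ) : diff p = 0 ↔ p.1 = p.2 := by
  rw [diff, sub_eq_zero, Nat.cast_inj]

theorem diff_nonneg (p : ℕ × ℕ) : diff p ≥ 0 ↔ p.2 ≤ p.1 := by
  rw [diff, ge_iff_le, sub_nonneg, Nat.cast_le]

/-- Configurations with integer registers: label, real registers and index registers. Registers are
numbered from `0`, and so are the values of index registers. -/
abbrev IntConfig : Type := ℕ × Store (ℕ × ℕ) × Store ℕ

namespace IntConfig

/-- The tuple `(Z_1, …, Z_{I_1})`. -/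
def tuple (s : IntConfig) : List (ℕ × ℕ) :=
  (List.range (s.2.2.get 0 + 1)).map s.2.1.get

/-- The initial configuration. -/
def init (x : List (ℕ × ℕ)) : IntConfig := (0, (x, (0, 0)), ([], x.length - 1))

/-- The effect of one instruction. -/
def exec (O : List (ℕ × ℕ) → Bool) (c : ℝ → ℕ × ℕ) (s : IntConfig) : Instr → IntConfig
  | .add i j k => (s.1 + 1, s.2.1.set i.natPred
      ((s.2.1.get j.natPred).1 + (s.2.1.get k.natPred).1,
        (s.2.1.get j.natPred).2 + (s.2.1.get k.natPred).2), s.2.2)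
  | .sub i j k => (s.1 + 1, s.2.1.set i.natPred
      ((s.2.1.get j.natPred).1 + (s.2.1.get k.natPred).2,
        (s.2.1.get j.natPred).2 + (s.2.1.get k.natPred).1), s.2.2)
  | .const j a => (s.1 + 1, s.2.1.set j.natPred (c a), s.2.2)
  | .ifZero j l₁ l₂ =>
      (bif (s.2.1.get j.natPred).1 == (s.2.1.get j.natPred).2 then l₁ else l₂, s.2)
  | .ifNonneg j l₁ l₂ =>
      (bif decide ((s.2.1.get j.natPred).2 ≤ (s.2.1.get j.natPred).1) then l₁ else l₂, s.2)
  | .copy j k =>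
      (s.1 + 1, s.2.1.set (s.2.2.get j.natPred) (s.2.1.get (s.2.2.get k.natPred)), s.2.2)
  | .indexOne j => (s.1 + 1, s.2.1, s.2.2.set j.natPred 0)
  | .indexSucc j => (s.1 + 1, s.2.1, s.2.2.set j.natPred (s.2.2.get j.natPred + 1))
  | .ifIndexEq j k l₁ l₂ =>
      (bif s.2.2.get j.natPred == s.2.2.get k.natPred then l₁ else l₂, s.2)
  | .ifOracle l₁ l₂ => (bif O s.tuple then l₁ else l₂, s.2)

theorem computable_tuple : Computable tuple :=
  (Primrec.list_map
    (Primrec.list_range.comp (Primrec.succ.comp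
      (Store.primrec_get.comp (Primrec.snd.comp Primrec.snd) (Primrec.const 0))))
    (Store.primrec_get.comp (Primrec.fst.comp (Primrec.snd.comp Primrec.fst))
      Primrec.snd).to₂).to_comp

theorem computable_init : Computable init :=
  ((Primrec.const 0).pair ((Primrec.id.pair (Primrec.const (0, 0))).pair
    ((Primrec.const []).pair (Primrec.pred.comp Primrec.list_length)))).to_comp

/-- The instruction is fixed, so its registers, labels and coded constant are constants of the
computable function; no encoding of instructions, which may contain arbitrary reals, is needed. -/
theorem computable_exec {O : List (ℕ × ℕ) → Bool} (hO : Computable O) (c : ℝ → ℕ × ℕ)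
    (i : Instr) : Computable fun s => exec O c s i := by
  have hl : Computable fun s : IntConfig => s.1 + 1 := Computable.succ.comp Computable.fst
  have hZ : Computable fun s : IntConfig => s.2.1 := Computable.fst.comp Computable.snd
  have hI : Computable fun s : IntConfig => s.2.2 := Computable.snd.comp Computable.snd
  have hz (j : ℕ) : Computable fun s : IntConfig => s.2.1.get j :=
    Store.computable_get hZ (Computable.const j)
  have hi (j : ℕ) : Computable fun s : IntConfig => s.2.2.get j :=
    Store.computable_get hI (Computable.const j)
  have hadd {f g : IntConfig → ℕ} (hf : Computable f) (hg : Computable g) :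
      Computable fun s => f s + g s := Primrec.nat_add.to_comp.comp hf hg
  have hbeq {f g : IntConfig → ℕ} (hf : Computable f) (hg : Computable g) :
      Computable fun s => f s == g s := Primrec.beq.to_comp.comp hf hg
  have hcond {b : IntConfig → Bool} (hb : Computable b) (l₁ l₂ : ℕ) :
      Computable fun s : IntConfig => (bif b s then l₁ else l₂, s.2) :=
    (Computable.cond hb (Computable.const l₁) (Computable.const l₂)).pair Computable.snd
  cases i with
  | add i j k =>
    exact hl.pair ((Store.computable_set hZ (Computable.const _)
      ((hadd (Computable.fst.comp (hz _)) (Computable.fst.comp (hz _))).pair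
        (hadd (Computable.snd.comp (hz _)) (Computable.snd.comp (hz _))))).pair hI)
  | sub i j k =>
    exact hl.pair ((Store.computable_set hZ (Computable.const _)
      ((hadd (Computable.fst.comp (hz _)) (Computable.snd.comp (hz _))).pair
        (hadd (Computable.snd.comp (hz _)) (Computable.fst.comp (hz _))))).pair hI)
  | const j a =>
    exact hl.pair ((Store.computable_set hZ (Computable.const _) (Computable.const _)).pair hI)
  | ifZero j l₁ l₂ =>
    exact hcond (hbeq (Computable.fst.comp (hz _)) (Computable.snd.comp (hz _))) _ _
  | ifNonneg j l₁ l₂ =>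
    exact hcond (Primrec.nat_le.decide.to_comp.comp (Computable.snd.comp (hz _))
      (Computable.fst.comp (hz _))) _ _
  | copy j k =>
    exact hl.pair ((Store.computable_set hZ (hi _) (Store.computable_get hZ (hi _))).pair hI)
  | indexOne j =>
    exact hl.pair (hZ.pair (Store.computable_set hI (Computable.const _) (Computable.const _)))
  | indexSucc j =>
    exact hl.pair (hZ.pair (Store.computable_set hI (Computable.const _)
      (Computable.succ.comp (hi _))))
  | ifIndexEq j k l₁ l₂ => exact hcond (hbeq (hi _) (hi _)) _ _
  | ifOracle l₁ l₂ => exact hcond (hO.comp computable_tuple) _ _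

/-- One step; a configuration that has stopped remains unchanged. -/
def step (O : List (ℕ × ℕ) → Bool) (c : ℝ → ℕ × ℕ) (M : Program) (s : IntConfig) : IntConfig :=
  (M[s.1]?.map (exec O c s)).getD s

/-- Since the program is fixed, fetching the instruction is a finite case distinction on the label:
induction on the list peels off label `0` and shifts the others down. For this the label is
separated from the configuration that is acted upon. -/
theorem computable_step {O : List (ℕ × ℕ) → Bool} (hO : Computable O) (c : ℝ → ℕ × ℕ)
    (M : Program) : Computable (step O c M) := by
  suffices h : ∀ M : Program, Computable fun p : ℕ × IntConfig =>
      (M[p.1]?.map (exec O c p.2)).getD p.2 by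
    have hp : Computable fun s : IntConfig => (s.1, s) := Computable.fst.pair Computable.id
    exact ((h M).comp hp).of_eq fun _ => rfl
  intro M
  induction M with
  | nil => simpa using Computable.snd
  | cons i M ih =>
    have hg : Computable fun p : ℕ × IntConfig => exec O c p.2 i :=
      (computable_exec hO c i).comp Computable.snd
    have hp : Computable fun q : (ℕ × IntConfig) × ℕ => (q.2, q.1.2) :=
      Computable.snd.pair (Computable.snd.comp Computable.fst)
    have hh : Computable₂ fun (p : ℕ × IntConfig) (l : ℕ) =>
        (M[l]?.map (exec O c p.2)).getD p.2 := (ih.comp hp).to₂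
    have h := Computable.nat_casesOn Computable.fst hg hh
    refine h.of_eq fun p => ?_
    rcases p with ⟨_ | l, s⟩ <;> simp

/-- The integer configuration `s` represents the configuration `c`. -/
structure Represents (s : IntConfig) (c : Config) : Prop where
  label : c.label = s.1
  Z (i : ℕ+) : c.Z i = diff (s.2.1.get i.natPred)
  I (i : ℕ+) : (c.I i).natPred = s.2.2.get i.natPred

theorem represents_init {x : List (ℕ × ℕ)} :
    (init x).Represents (AddBSS.init (x.map diff)) where
  label := rfl
  Z i := by
    have h : diff (0, 0) = 0 := by simp [diff]
    simp only [AddBSS.init, init, Store.get, List.getD_eq_getElem?_getD, List.getElem?_map]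
    cases x[i.natPred]? <;> simp [h]
  I i := by
    simp only [AddBSS.init, init, Store.get, List.length_map]
    simp only [List.length_nil, Nat.not_lt_zero, not_false_eq_true, getElem?_neg, Option.getD_none]
    -- For the empty list both conventions yield the first register: `toPNat'` sends `0` to `1`, and
    -- `0 - 1 = 0`.
    rcases x.length with _ | n
    · rfl
    · rfl

theorem Represents.tuple {s : IntConfig} {c : Config} (h : s.Represents c) :
    c.tuple = s.tuple.map diff := by
  have h1 : (c.I 1 : ℕ) = s.2.2.get 0 + 1 := by
    have := h.I 1
    rw [← PNat.natPred_add_one, this]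
    rfl
  rw [Config.tuple, IntConfig.tuple, h1, List.map_map]
  refine List.map_congr_left fun i _ => ?_
  simp [h.Z, Nat.natPred_succPNat]

/-- Nonempty tuples suffice in `hO` because a query always includes `Z_1`; the values of `e` matter
only at `0` and `1`, the sole constants allowed. -/
theorem Represents.exec {O : List (ℕ × ℕ) → Bool} {B : Set (List ℝ)} {e : ℝ → ℕ × ℕ}
    (hO : ∀ x ≠ [], O x = true ↔ x.map diff ∈ B) (he : ∀ a, a = 0 ∨ a = 1 → diff (e a) = a)
    {s : IntConfig} {c : Config} (h : s.Represents c) {i : Instr} (hi : i.IsAddOneOracle) :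
    (s.exec O e i).Represents (i.exec B c) := by
  have upd (f : ℕ+ → ℝ) (S : Store (ℕ × ℕ)) (hf : ∀ i, f i = diff (S.get i.natPred))
      (j : ℕ+) (r : ℝ) (p : ℕ × ℕ) (hp : r = diff p) (i : ℕ+) :
      Function.update f j r i = diff ((S.set j.natPred p).get i.natPred) := by
    rw [Store.get_set, Function.update_apply]
    simp only [PNat.natPred_inj]
    split_ifs
    · exact hp
    · exact hf i
  have updI (f : ℕ+ → ℕ+) (S : Store ℕ) (hf : ∀ i, (f i).natPred = S.get i.natPred)
      (j : ℕ+) (r : ℕ+) (p : ℕ) (hp : r.natPred = p) (i : ℕ+) :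
      (Function.update f j r i).natPred = (S.set j.natPred p).get i.natPred := by
    rw [Store.get_set, Function.update_apply]
    simp only [PNat.natPred_inj]
    split_ifs
    · exact hp
    · exact hf i
  cases i with
  | add i j k =>
    refine ⟨congrArg (· + 1) h.label, upd _ _ h.Z _ _ _ ?_, h.I⟩
    rw [h.Z, h.Z]
    simp only [diff]
    push_cast
    ring
  | sub i j k =>
    refine ⟨congrArg (· + 1) h.label, upd _ _ h.Z _ _ _ ?_, h.I⟩
    rw [h.Z, h.Z]
    simp only [diff]
    push_cast
    ring
  | const j a => exact ⟨congrArg (· + 1) h.label, upd _ _ h.Z _ _ _ (he a hi).symm, h.I⟩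
  | ifZero j l₁ l₂ => exact hi.elim
  | ifNonneg j l₁ l₂ =>
    refine ⟨?_, h.Z, h.I⟩
    simp only [Instr.exec, IntConfig.exec, h.Z, diff_nonneg, Bool.cond_decide]
  | copy j k =>
    refine ⟨congrArg (· + 1) h.label, ?_, h.I⟩
    simp only [Instr.exec, IntConfig.exec]
    rw [← h.I j]
    refine upd _ _ h.Z _ _ _ ?_
    rw [h.Z, h.I]
  | indexOne j => exact ⟨congrArg (· + 1) h.label, h.Z, updI _ _ h.I _ _ _ rfl⟩
  | indexSucc j =>
    refine ⟨congrArg (· + 1) h.label, h.Z, updI _ _ h.I _ _ _ ?_⟩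
    rw [← h.I, PNat.natPred_add_one, PNat.natPred, PNat.add_coe]
    rfl
  | ifIndexEq j k l₁ l₂ =>
    refine ⟨?_, h.Z, h.I⟩
    simp only [Instr.exec, IntConfig.exec]
    rw [← h.I, ← h.I, Bool.cond_eq_ite]
    simp only [beq_iff_eq, PNat.natPred_inj]
  | ifOracle l₁ l₂ =>
    refine ⟨?_, h.Z, h.I⟩
    have hne : s.tuple ≠ [] := by simp [IntConfig.tuple]
    simp only [Instr.exec, IntConfig.exec, h.tuple, ← hO _ hne, Bool.cond_eq_ite]

theorem Represents.step {O : List (ℕ × ℕ) → Bool} {B : Set (List ℝ)} {e : ℝ → ℕ × ℕ}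
    (hO : ∀ x ≠ [], O x = true ↔ x.map diff ∈ B) (he : ∀ a, a = 0 ∨ a = 1 → diff (e a) = a)
    {M : Program} (hM : M ∈ MAddOneOracle) {s : IntConfig} {c c' : Config} (h : s.Represents c)
    (hc : AddBSS.step B M c = some c') : (step O e M s).Represents c' := by
  rw [AddBSS.step, h.label, Option.map_eq_some_iff] at hc
  obtain ⟨i, hi, rfl⟩ := hc
  rw [IntConfig.step, hi]
  exact h.exec hO he (hM i (List.mem_of_getElem? hi))

theorem exists_represents {O : List (ℕ × ℕ) → Bool} {B : Set (List ℝ)} {e : ℝ → ℕ × ℕ}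
    (hO : ∀ x ≠ [], O x = true ↔ x.map diff ∈ B) (he : ∀ a, a = 0 ∨ a = 1 → diff (e a) = a)
    {M : Program} (hM : M ∈ MAddOneOracle) {s : IntConfig} {c c' : Config} (h : s.Represents c)
    (hc : StateTransition.Reaches (AddBSS.step B M) c c') :
    ∃ k, ((step O e M)^[k] s).Represents c' := by
  induction hc with
  | refl => exact ⟨0, h⟩
  | tail _ hs ih =>
    obtain ⟨k, hk⟩ := ih
    refine ⟨k + 1, ?_⟩
    rw [Function.iterate_succ_apply']
    exact hk.step hO he hM hs

theorem iterate_step_of_halted {O : List (ℕ × ℕ) → Bool} {e : ℝ → ℕ × ℕ} {M : Program}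
    {s : IntConfig} (h : M.length ≤ s.1) (k : ℕ) : (step O e M)^[k] s = s :=
  Function.iterate_fixed (by simp [step, h]) k

theorem computable_iterate_step {O : List (ℕ × ℕ) → Bool} (hO : Computable O) (e : ℝ → ℕ × ℕ)
    (M : Program) {α : Type} [Primcodable α] {f : α → IntConfig} {k : α → ℕ}
    (hf : Computable f) (hk : Computable k) : Computable fun a => (step O e M)^[k a] (f a) := by
  refine (Computable.nat_rec hk hf
    (h := fun _ p => step O e M p.2)
    ((computable_step hO e M).comp (Computable.snd.comp Computable.snd)).to₂).of_eq fun a => ?_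
  induction k a with
  | zero => rfl
  | succ n ih => rw [Function.iterate_succ_apply', ← ih]

end IntConfig

/-- A set that an additive oracle machine decides is decidable on integer tuples in the classical
sense if its oracle set is. -/
theorem exists_computable_of_decides {O : List (ℕ × ℕ) → Bool} (hOc : Computable O)
    {A B : Set (List ℝ)} (hO : ∀ x ≠ [], O x = true ↔ x.map diff ∈ B) {M : Program}
    (hM : M ∈ MAddOneOracle) (hdec : Decides B M A) :
    ∃ f : List (ℕ × ℕ) → Bool, Computable f ∧ ∀ x ≠ [], f x = true ↔ x.map diff ∈ A := by
  classical
  let e : ℝ → ℕ × ℕ := fun a => if a = 1 then (1, 0) else (0, 0)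
  have he : ∀ a, a = 0 ∨ a = 1 → diff (e a) = a := by
    rintro a (rfl | rfl) <;> simp [e, diff]
  -- The empty list is replaced by `[(0, 0)]`, so that the simulated machine halts on every list and
  -- the search for a halting time is total.
  let s₀ : List (ℕ × ℕ) → IntConfig := fun x => IntConfig.init (x.headI :: x.tail)
  have hs₀ : Computable s₀ := IntConfig.computable_init.comp
    (Primrec.list_cons.comp Primrec.list_headI Primrec.list_tail).to_comp
  let run : List (ℕ × ℕ) → ℕ → IntConfig := fun x k => (IntConfig.step O e M)^[k] (s₀ x)
  have key (x : List (ℕ × ℕ)) : ∃ k c, (run x k).Represents c ∧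
      M.length ≤ (run x k).1 ∧ c.tuple = charFun A ((x.headI :: x.tail).map diff) := by
    have h := hdec ((x.headI :: x.tail).map diff) (by simp [RInf])
    rw [result] at h
    have h := h ▸ Part.mem_some _
    obtain ⟨c, hc, hct⟩ := (Part.mem_map_iff _).1 h
    rw [StateTransition.mem_eval] at hc
    obtain ⟨k, hk⟩ := IntConfig.exists_represents hO he hM IntConfig.represents_init hc.1
    refine ⟨k, c, hk, ?_, hct⟩
    have h2 := hc.2
    rw [step, Option.map_eq_none_iff, List.getElem?_eq_none_iff, hk.label] at h2
    exact h2
  have hex (x : List (ℕ × ℕ)) : ∃ k, M.length ≤ (run x k).1 :=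
    let ⟨k, _, _, hk, _⟩ := key x
    ⟨k, hk⟩
  have hrun {α : Type} [Primcodable α] {f : α → List (ℕ × ℕ)} {k : α → ℕ} (hf : Computable f)
      (hk : Computable k) : Computable fun a => run (f a) (k a) :=
    IntConfig.computable_iterate_step hOc e M (hs₀.comp hf) hk
  have hfind : Computable fun x => Nat.find (hex x) :=
    Computable.find (P := fun x k => M.length ≤ (run x k).1) (Computable.computablePred
      (Primrec.nat_le.decide.to_comp.comp (Computable.const _)
        (Computable.fst.comp (hrun Computable.fst Computable.snd)))) hex
  -- The output `Z_1` is `0` or `1`, so acceptance means that the two components of its code differ.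
  refine ⟨fun x => !((run x (Nat.find (hex x))).2.1.get 0).1 ==
    ((run x (Nat.find (hex x))).2.1.get 0).2, ?_, fun x hx => ?_⟩
  · have hz : Computable fun x => (run x (Nat.find (hex x))).2.1.get 0 :=
      Store.computable_get (Computable.fst.comp (Computable.snd.comp (hrun Computable.id hfind)))
        (Computable.const 0)
    exact Primrec.not.to_comp.comp
      (Primrec.beq.to_comp.comp (Computable.fst.comp hz) (Computable.snd.comp hz))
  · obtain ⟨k, c, hr, hk, ht⟩ := key x
    have hx' : x.headI :: x.tail = x := by
      cases x with
      | nil => exact absurd rfl hx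
      | cons a l => rfl
    rw [hx'] at ht
    have hle := Nat.find_min' (hex x) hk
    -- The time `k` may exceed the least halting time, but halted configurations are fixed points.
    have heq : run x k = run x (Nat.find (hex x)) := by
      obtain ⟨d, hd⟩ := Nat.exists_eq_add_of_le' hle
      rw [hd]
      simp only [run]
      rw [Function.iterate_add_apply]
      exact IntConfig.iterate_step_of_halted (Nat.find_spec (hex x)) d
    show (!((run x (Nat.find (hex x))).2.1.get 0).1 ==
      ((run x (Nat.find (hex x))).2.1.get 0).2) = true ↔ _
    rw [← heq]
    have hZ : c.Z 1 = A.indicator (fun _ => (1 : ℝ)) (x.map diff) := by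
      have h0 := congrArg (·[0]?) ht
      simpa [Config.tuple, charFun, show Nat.succPNat 0 = 1 from rfl] using h0
    have hd : diff ((run x k).2.1.get 0) = A.indicator (fun _ => (1 : ℝ)) (x.map diff) := by
      rw [← hZ, hr.Z]
      rfl
    have h0 := diff_eq_zero ((run x k).2.1.get 0)
    rw [hd] at h0
    by_cases hA : x.map diff ∈ A
    · simp only [hA, Set.indicator_of_mem, one_ne_zero, false_iff] at h0
      simp [hA, h0]
    · simp only [hA, not_false_eq_true, Set.indicator_of_notMem, true_iff] at h0
      simp [hA, h0]


/-! ### While-programs on natural number registers -/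

/-- While-programs with registers numbered by natural numbers. -/
inductive Cmd : Type
  | skip
  | zero (i : ℕ)
  | inc (i : ℕ)
  | dec (i : ℕ)
  | move (i j : ℕ)
  | seq (c d : Cmd)
  /-- `while i ≠ 0 do c` -/
  | loop (i : ℕ) (c : Cmd)

/-- `Runs c σ τ`: the program `c`, started with register contents `σ`, stops with `τ`. -/
inductive Runs : Cmd → (ℕ → ℕ) → (ℕ → ℕ) → Prop
  | skip {σ} : Runs .skip σ σ
  | zero {σ i} : Runs (.zero i) σ (Function.update σ i 0)
  | inc {σ i} : Runs (.inc i) σ (Function.update σ i (σ i + 1))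
  | dec {σ i n} (h : σ i = n + 1) : Runs (.dec i) σ (Function.update σ i n)
  | move {σ i j} : Runs (.move i j) σ (Function.update σ i (σ j))
  | seq {c d σ τ ρ} (hc : Runs c σ τ) (hd : Runs d τ ρ) : Runs (.seq c d) σ ρ
  | loop_done {c σ i} (h : σ i = 0) : Runs (.loop i c) σ σ
  | loop_step {c σ τ ρ i} (h : σ i ≠ 0) (hc : Runs c σ τ) (hl : Runs (.loop i c) τ ρ) :
      Runs (.loop i c) σ ρ

/-- For all argument registers `r` below `b` some while-program computes `f` into register `b`,
without changing the registers below `b`. -/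
def Implementable {n : ℕ} (f : List.Vector ℕ n →. ℕ) : Prop :=
  ∀ (r : Fin n → ℕ) (b : ℕ), (∀ i, r i < b) → ∃ c : Cmd, ∀ (σ : ℕ → ℕ) (v : List.Vector ℕ n),
    (∀ i, v.get i = σ (r i)) → ∀ y ∈ f v, ∃ τ, Runs c σ τ ∧ τ b = y ∧ ∀ j < b, τ j = σ j

theorem mem_mOfFn {n : ℕ} (g : Fin n → Part ℕ) (w : List.Vector ℕ n) :
    w ∈ List.Vector.mOfFn g ↔ ∀ i, w.get i ∈ g i := by
  induction n with
  | zero => simp [List.Vector.mOfFn, List.Vector.eq_nil w]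
  | succ n ih =>
    obtain ⟨a, w, rfl⟩ := w.exists_eq_cons
    simp only [List.Vector.mOfFn, Part.bind_eq_bind, Part.mem_bind_iff, Part.pure_eq_some,
      Part.mem_some_iff, ih, Fin.forall_fin_succ, List.Vector.get_zero, List.Vector.head_cons,
      List.Vector.get_cons_succ]
    constructor
    · rintro ⟨a', ha, w', hw, he⟩
      have h1 := congrArg List.Vector.head he
      have h2 := congrArg List.Vector.tail he
      simp only [List.Vector.head_cons, List.Vector.tail_cons] at h1 h2
      exact ⟨h1 ▸ ha, h2 ▸ hw⟩
    · rintro ⟨ha, hw⟩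
      exact ⟨a, ha, w, hw, rfl⟩

namespace Implementable

theorem zero : Implementable (n := 0) fun _ => Part.some 0 := fun _ b _ =>
  ⟨.zero b, fun σ _ _ y hy => ⟨_, .zero, by simpa using (Part.mem_some_iff.1 hy).symm,
    fun j hj => Function.update_of_ne hj.ne _ _⟩⟩

theorem succ : Implementable (n := 1) fun v => Part.some v.head.succ := fun r b _ =>
  ⟨.seq (.move b (r 0)) (.inc b), fun σ v hv y hy =>
    ⟨_, .seq .move .inc, by
      have h0 := hv 0
      rw [List.Vector.get_zero] at h0
      simpa [← h0] using (Part.mem_some_iff.1 hy).symm,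
    fun j hj => by simp [Function.update_of_ne hj.ne]⟩⟩

theorem get {n : ℕ} (i : Fin n) : Implementable fun v => Part.some (v.get i) := fun r b _ =>
  ⟨.move b (r i), fun σ v hv y hy => ⟨_, .move, by
    simpa [← hv i] using (Part.mem_some_iff.1 hy).symm,
    fun j hj => Function.update_of_ne hj.ne _ _⟩⟩

/-- Finitely many functions can be computed into consecutive registers. -/
theorem exists_family {m n : ℕ} {g : Fin n → List.Vector ℕ m →. ℕ}
    (hg : ∀ i, Implementable (g i)) (r : Fin m → ℕ) (b : ℕ) (hr : ∀ i, r i < b) (k : ℕ)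
    (hk : k ≤ n) :
    ∃ c : Cmd, ∀ (σ : ℕ → ℕ) (v : List.Vector ℕ m), (∀ i, v.get i = σ (r i)) →
      ∀ w : List.Vector ℕ n, (∀ i, w.get i ∈ g i v) →
      ∃ τ, Runs c σ τ ∧ (∀ i : Fin n, i.1 < k → τ (b + i) = w.get i) ∧ ∀ j < b, τ j = σ j := by
  induction k with
  | zero => exact ⟨.skip, fun σ _ _ _ _ => ⟨σ, .skip, by simp, by simp⟩⟩
  | succ k ih =>
    obtain ⟨c, hc⟩ := ih (by omega)
    obtain ⟨d, hd⟩ := hg ⟨k, hk⟩ r (b + k) (fun i => (hr i).trans_le (by omega))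
    refine ⟨.seq c d, fun σ v hv w hw => ?_⟩
    obtain ⟨τ, h1, h2, h3⟩ := hc σ v hv w hw
    obtain ⟨ρ, h4, h5, h6⟩ := hd τ v (fun i => by rw [hv, h3 _ (hr i)]) _ (hw ⟨k, hk⟩)
    refine ⟨ρ, .seq h1 h4, fun i hi => ?_, fun j hj => by rw [h6 j (by omega), h3 j hj]⟩
    rcases Nat.lt_succ_iff_lt_or_eq.1 hi with h | h
    · rw [h6 _ (by omega), h2 i h]
    · obtain rfl : i = ⟨k, hk⟩ := Fin.ext h
      exact h5

/-- The values of the `g i` go to `b, …, b + n - 1`, and `f` then works from `b + n` upwards. The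
freedom to choose `b` in `Implementable` is what keeps subroutines from overwriting the caller's
registers. -/
theorem comp {m n : ℕ} {f : List.Vector ℕ n →. ℕ} {g : Fin n → List.Vector ℕ m →. ℕ}
    (hf : Implementable f) (hg : ∀ i, Implementable (g i)) :
    Implementable fun v => (List.Vector.mOfFn fun i => g i v) >>= f := fun r b hr => by
  obtain ⟨c, hc⟩ := exists_family hg r b hr n le_rfl
  obtain ⟨d, hd⟩ := hf (fun i => b + i) (b + n) (fun i => by omega)
  refine ⟨.seq c (.seq d (.move b (b + n))), fun σ v hv y hy => ?_⟩
  obtain ⟨w, hw, hy⟩ := Part.mem_bind_iff.1 hy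
  rw [mem_mOfFn] at hw
  obtain ⟨τ, h1, h2, h3⟩ := hc σ v hv w hw
  obtain ⟨ρ, h4, h5, h6⟩ := hd τ w (fun i => (h2 i i.2).symm) y hy
  refine ⟨_, .seq h1 (.seq h4 .move), by simpa using h5, fun j hj => ?_⟩
  rw [Function.update_of_ne hj.ne, h6 j (by omega), h3 j hj]

theorem prec {n : ℕ} {f : List.Vector ℕ n → ℕ} {g : List.Vector ℕ (n + 2) → ℕ}
    (hf : Implementable fun v => Part.some (f v)) (hg : Implementable fun v => Part.some (g v)) :
    Implementable fun v : List.Vector ℕ (n + 1) =>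
      Part.some (v.head.rec (f v.tail) fun y IH => g (y ::ᵥ IH ::ᵥ v.tail)) := fun r b hr => by
  obtain ⟨c, hc⟩ := hf (fun i => r i.succ) (b + 3) (fun i => (hr _).trans (by omega))
  obtain ⟨d, hd⟩ := hg (Fin.cons (b + 1) (Fin.cons b fun i => r i.succ)) (b + 3) (fun i => by
    refine Fin.cases (by simp) (fun i => Fin.cases (by simp) (fun i => ?_) i) i
    simpa using (hr _).trans (by omega))
  -- Register `b` holds the accumulated value, `b + 1` the recursion index, `b + 2` the number of
  -- rounds left, and `b + 3` receives the results of `f` and `g`.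
  let body : Cmd := .seq d (.seq (.move b (b + 3)) (.seq (.inc (b + 1)) (.dec (b + 2))))
  refine ⟨.seq (.move (b + 2) (r 0)) (.seq c (.seq (.move b (b + 3)) (.seq (.zero (b + 1))
    (.loop (b + 2) body)))), fun σ v hv y hy => ?_⟩
  obtain ⟨a, v, rfl⟩ := v.exists_eq_cons
  simp only [List.Vector.head_cons, List.Vector.tail_cons, Part.mem_some_iff] at hy
  let F : ℕ → ℕ := fun a => a.rec (f v) fun y IH => g (y ::ᵥ IH ::ᵥ v)
  have hv0 : a = σ (r 0) := by simpa using hv 0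
  have hvs (i : Fin n) : v.get i = σ (r i.succ) := by simpa using hv i.succ
  -- The invariant `τ b = F k`, with `m` rounds left, is proved by induction on `m`.
  have loop (m : ℕ) : ∀ (k : ℕ) (τ : ℕ → ℕ), τ (b + 2) = m → τ (b + 1) = k → τ b = F k →
      (∀ j < b, τ j = σ j) →
      ∃ ρ, Runs (.loop (b + 2) body) τ ρ ∧ ρ b = F (k + m) ∧ ∀ j < b, ρ j = σ j := by
    induction m with
    | zero => exact fun k τ h2 _ h0 hσ => ⟨τ, .loop_done h2, h0, hσ⟩
    | succ m ih =>
      intro k τ h2 h1 h0 hσ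
      obtain ⟨τ', e1, e2, e3⟩ := hd τ (k ::ᵥ F k ::ᵥ v) (fun i => by
        refine Fin.cases (by simp [h1]) (fun i => Fin.cases ?_ (fun i => ?_) i) i
        · rw [List.Vector.get_cons_succ, List.Vector.get_zero]
          simpa using h0.symm
        · simpa [hσ _ (hr _)] using hvs i) _ (Part.mem_some _)
      obtain ⟨ρ, e4, e5, e6⟩ := ih (k + 1) (Function.update (Function.update (Function.update
          τ' b (τ' (b + 3))) (b + 1) (k + 1)) (b + 2) m) (by simp)
        (by simp) (by simpa using e2) (fun j hj => by
          rw [Function.update_of_ne (by omega), Function.update_of_ne (by omega),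
            Function.update_of_ne (by omega), e3 j (by omega), hσ j hj])
      refine ⟨ρ, .loop_step (by omega) (.seq e1 (.seq .move (.seq .inc (.dec (n := m) ?_)))) ?_,
        by rw [e5, show k + 1 + m = k + (m + 1) by omega], e6⟩
      · simp [e3, h2]
      · convert e4 using 3
        simp [e3, h1]
  obtain ⟨τ, h1, h2, h3⟩ := hc (Function.update σ (b + 2) (σ (r 0))) v (fun i => by
    have := hr i.succ
    rw [Function.update_of_ne (by omega), hvs]) _ (Part.mem_some _)
  obtain ⟨ρ, h4, h5, h6⟩ := loop a 0
    (Function.update (Function.update τ b (τ (b + 3))) (b + 1) 0)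
    (by simp [h3, hv0]) (by simp) (by simpa [F] using h2) (fun j hj => by
      rw [Function.update_of_ne (by omega), Function.update_of_ne (by omega), h3 j (by omega),
        Function.update_of_ne (by omega)])
  refine ⟨ρ, .seq .move (.seq h1 (.seq .move (.seq .zero h4))), ?_, h6⟩
  rw [h5, hy, Nat.zero_add]

/-- Register `b` holds the candidate and `b + 1` the value of `f` there; the loop increments the
candidate until that value vanishes. Minimality of `y` keeps the loop running before `y`. -/
theorem rfind {n : ℕ} {f : List.Vector ℕ (n + 1) → ℕ}
    (hf : Implementable fun v => Part.some (f v)) :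
    Implementable fun v => Nat.rfind fun n => Part.some (f (n ::ᵥ v) = 0) := fun r b hr => by
  obtain ⟨c, hc⟩ := hf (Fin.cons b r) (b + 1) (fun i => by
    refine Fin.cases (by simp) (fun i => ?_) i
    simpa using (hr i).trans b.lt_succ_self)
  refine ⟨.seq (.zero b) (.seq c (.loop (b + 1) (.seq (.inc b) c))), fun σ v hv y hy => ?_⟩
  have hy0 : f (y ::ᵥ v) = 0 := by simpa using Nat.rfind_spec hy
  have hy1 {k : ℕ} (hk : k < y) : f (k ::ᵥ v) ≠ 0 := by simpa using Nat.rfind_min hy hk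
  have call (k : ℕ) (τ : ℕ → ℕ) (h0 : τ b = k) (hσ : ∀ j < b, τ j = σ j) :
      ∃ ρ, Runs c τ ρ ∧ ρ (b + 1) = f (k ::ᵥ v) ∧ ρ b = k ∧ ∀ j < b, ρ j = σ j := by
    obtain ⟨ρ, h1, h2, h3⟩ := hc τ (k ::ᵥ v) (fun i => by
      refine Fin.cases (by simp [h0]) (fun i => ?_) i
      simpa [hσ _ (hr i)] using hv i) _ (Part.mem_some _)
    exact ⟨ρ, h1, h2, by rw [h3 b (by omega), h0], fun j hj => by rw [h3 j (by omega), hσ j hj]⟩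
  have loop (m : ℕ) : ∀ (k : ℕ) (τ : ℕ → ℕ), k + m = y → τ (b + 1) = f (k ::ᵥ v) → τ b = k →
      (∀ j < b, τ j = σ j) →
      ∃ ρ, Runs (.loop (b + 1) (.seq (.inc b) c)) τ ρ ∧ ρ b = y ∧ ∀ j < b, ρ j = σ j := by
    induction m with
    | zero =>
      intro k τ hk h1 h0 hσ
      obtain rfl : k = y := hk
      exact ⟨τ, .loop_done (by rw [h1, hy0]), h0, hσ⟩
    | succ m ih =>
      intro k τ hk h1 h0 hσ
      obtain ⟨τ', e1, e2, e3, e4⟩ := call (k + 1) (Function.update τ b (τ b + 1)) (by simp [h0])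
        (fun j hj => by rw [Function.update_of_ne hj.ne, hσ j hj])
      obtain ⟨ρ, e5, e6⟩ := ih (k + 1) τ' (by omega) e2 e3 e4
      exact ⟨ρ, .loop_step (by rw [h1]; exact hy1 (by omega)) (.seq .inc e1) e5, e6⟩
  obtain ⟨τ, h1, h2, h3, h4⟩ := call 0 (Function.update σ b 0) (by simp)
    (fun j hj => Function.update_of_ne hj.ne _ _)
  obtain ⟨ρ, h5, h6⟩ := loop y 0 τ (by omega) h2 h3 h4
  exact ⟨ρ, .seq .zero (.seq h1 h5), h6⟩

theorem of_primrec' {n : ℕ} {f : List.Vector ℕ n → ℕ} (hf : Nat.Primrec' f) :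
    Implementable fun v => Part.some (f v) := by
  induction hf with
  | zero => exact zero
  | succ => exact succ
  | get i => exact get i
  | comp g _ _ hf hg => simpa using hf.comp hg
  | prec _ _ hf hg => exact hf.prec hg

theorem of_partrec' {n : ℕ} {f : List.Vector ℕ n →. ℕ} (hf : Nat.Partrec' f) :
    Implementable f := by
  induction hf with
  | prim hf => exact of_primrec' hf
  | comp g _ _ hf hg => exact hf.comp hg
  | rfind _ hf => exact hf.rfind

end Implementable

/-- While-programs compute all computable functions. -/
theorem exists_cmd_of_computable {f : ℕ → ℕ} (hf : Computable f) :
    ∃ c : Cmd, ∀ σ : ℕ → ℕ, ∃ τ, Runs c σ τ ∧ τ 1 = f (σ 0) := by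
  have h : Implementable (n := 1) fun v => (f v.head : Part ℕ) :=
    .of_partrec' (Nat.Partrec'.part_iff₁.2 hf.partrec)
  obtain ⟨c, hc⟩ := h (fun _ => 0) 1 (fun _ => Nat.one_pos)
  refine ⟨c, fun σ => ?_⟩
  obtain ⟨τ, h1, h2, _⟩ := hc σ (σ 0 ::ᵥ List.Vector.nil) (fun i => by simp [Subsingleton.elim i 0])
    (f (σ 0)) (by simp)
  exact ⟨τ, h1, h2⟩


/-! ### Halting and divergence of machine runs -/

open StateTransition (Reaches)

theorem step_eq {O : Set (List ℝ)} {M : Program} {c : Config} {i : Instr}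
    (h : M[c.label]? = some i) : step O M c = some (i.exec O c) := by
  rw [step, h, Option.map_some]

theorem Reaches.head_of_instr {O : Set (List ℝ)} {M : Program} {c d : Config} {i : Instr}
    (h : M[c.label]? = some i) (hr : Reaches (step O M) (i.exec O c) d) :
    Reaches (step O M) c d :=
  Relation.ReflTransGen.head (step_eq h) hr

theorem Reaches.of_instr {O : Set (List ℝ)} {M : Program} {c : Config} {i : Instr}
    (h : M[c.label]? = some i) : Reaches (step O M) c (i.exec O c) :=
  Reaches.head_of_instr h .refl

/-- A machine that enters a set of configurations in which it can always make a further step without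
leaving the set does not stop. -/
theorem result_eq_none {O : Set (List ℝ)} {M : Program} {x : List ℝ} {c : Config}
    (hc : Reaches (step O M) (init x) c) (S : Set Config) (hcS : c ∈ S)
    (hS : ∀ d ∈ S, ∃ d' ∈ S, step O M d = some d') : result O M x = Part.none := by
  rw [result, StateTransition.reaches_eval hc, Part.eq_none_iff]
  intro y hy
  obtain ⟨e, hev, -⟩ := (Part.mem_map_iff _).1 hy
  obtain ⟨he, hn⟩ := StateTransition.mem_eval.1 hev
  have heS : e ∈ S := by
    clear hn hy hev
    induction he with
    | refl => exact hcS
    | tail _ hs ih =>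
      obtain ⟨d', hd', h⟩ := hS _ ih
      rw [Option.mem_def, h] at hs
      exact Option.some.inj hs ▸ hd'
  obtain ⟨d', -, h⟩ := hS e heS
  rw [hn] at h
  exact absurd h (by simp)

theorem result_eq_none_of_step_eq {O : Set (List ℝ)} {M : Program} {x : List ℝ} {c : Config}
    (hc : Reaches (step O M) (init x) c) (h : step O M c = some c) :
    result O M x = Part.none :=
  result_eq_none hc {c} rfl fun _ hd => ⟨c, rfl, by rw [hd, h]⟩

theorem result_eq_some {O : Set (List ℝ)} {M : Program} {x : List ℝ} {c : Config}
    (hc : Reaches (step O M) (init x) c) (h : step O M c = none) :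
    result O M x = Part.some c.tuple :=
  Part.eq_some_iff.2 (Part.mem_map _ (StateTransition.mem_eval.2 ⟨hc, h⟩))

/-! ### Compilation of while-programs -/

/-- The real register of an additive machine that holds the natural register `i`. The registers
`Z_1` and `Z_2` hold the constants `1` and `0`. -/
def reg (i : ℕ) : ℕ+ := (i + 2).succPNat

/-- The instructions for a while-program, to be placed at label `off`. -/
def Cmd.code : Cmd → ℕ → Program
  | .skip, _ => []
  | .zero i, _ => [.add (reg i) 2 2]
  | .inc i, _ => [.add (reg i) (reg i) 1]
  | .dec i, _ => [.sub (reg i) (reg i) 1]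
  | .move i j, _ => [.add (reg i) (reg j) 2]
  | .seq c d, off => c.code off ++ d.code (off + (c.code off).length)
  | .loop i c, off => .ifZero (reg i) (off + (c.code (off + 1)).length + 2) (off + 1) ::
      (c.code (off + 1) ++ [.ifZero 2 off off])

theorem Cmd.isAddOneEq_of_mem_code (c : Cmd) (off : ℕ) : ∀ i ∈ c.code off, i.IsAddOneEq := by
  induction c generalizing off with
  | seq c d hc hd =>
    intro i hi
    rcases List.mem_append.1 hi with h | h
    exacts [hc _ i h, hd _ i h]
  | loop j c hc =>
    intro i hi
    simp only [Cmd.code, List.mem_cons, List.mem_append, List.not_mem_nil, or_false] at hi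
    rcases hi with rfl | h | rfl
    exacts [trivial, hc _ i h, trivial]
  | _ => simp [Cmd.code, Instr.IsAddOneEq]

/-- The program `M` contains the instructions `l` at label `off`. -/
def CodeAt (M : Program) (off : ℕ) (l : Program) : Prop :=
  ∀ i < l.length, M[off + i]? = l[i]?

theorem CodeAt.head {M : Program} {off : ℕ} {i : Instr} {l : Program}
    (h : CodeAt M off (i :: l)) : M[off]? = some i := h 0 (by simp)

theorem CodeAt.tail {M : Program} {off : ℕ} {i : Instr} {l : Program}
    (h : CodeAt M off (i :: l)) : CodeAt M (off + 1) l := fun j hj => by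
  have := h (j + 1) (by simpa using hj)
  rwa [List.getElem?_cons_succ, ← Nat.add_assoc, Nat.add_right_comm] at this

theorem CodeAt.left {M : Program} {off : ℕ} {l₁ l₂ : Program} (h : CodeAt M off (l₁ ++ l₂)) :
    CodeAt M off l₁ := fun j hj => by
  rw [h j (by rw [List.length_append]; omega), List.getElem?_append_left hj]

theorem CodeAt.right {M : Program} {off : ℕ} {l₁ l₂ : Program} (h : CodeAt M off (l₁ ++ l₂)) :
    CodeAt M (off + l₁.length) l₂ := fun j hj => by
  rw [Nat.add_assoc, h _ (by rw [List.length_append]; omega),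
    List.getElem?_append_right (by omega), Nat.add_sub_cancel_left]

/-- The real registers `Z` hold the natural registers `σ`. -/
structure Holds (σ : ℕ → ℕ) (Z : ℕ+ → ℝ) : Prop where
  one : Z 1 = 1
  zero : Z 2 = 0
  reg (i : ℕ) : Z (reg i) = σ i

theorem reg_inj {i j : ℕ} : reg i = reg j ↔ i = j := by
  simp [reg, ← PNat.coe_inj]

theorem Holds.update {σ : ℕ → ℕ} {Z : ℕ+ → ℝ} (h : Holds σ Z) (i : ℕ) {r : ℝ} {n : ℕ}
    (hr : r = n) : Holds (Function.update σ i n) (Function.update Z (AddBSS.reg i) r) where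
  one := by
    rw [Function.update_of_ne, h.one]
    simp [AddBSS.reg, ← PNat.coe_inj]
  zero := by
    rw [Function.update_of_ne, h.zero]
    simp [AddBSS.reg, ← PNat.coe_inj]
  reg j := by
    simp only [Function.update_apply, reg_inj]
    split_ifs
    exacts [hr, h.reg j]

/-- Induction on the run. A decrement runs only on a positive register, so the subtraction of reals
stays within the naturals, and `Z_1 = 1`, `Z_2 = 0` supply the constants. -/
theorem Runs.reaches {O : Set (List ℝ)} {M : Program} {p : Cmd} {σ τ : ℕ → ℕ} (h : Runs p σ τ) :
    ∀ (off : ℕ) (Z : ℕ+ → ℝ) (I : ℕ+ → ℕ+), CodeAt M off (p.code off) → Holds σ Z →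
      ∃ Z', Holds τ Z' ∧ Reaches (step O M) ⟨off, Z, I⟩ ⟨off + (p.code off).length, Z', I⟩ := by
  induction h with
  | skip => exact fun off Z I _ hZ => ⟨Z, hZ, .refl⟩
  | @zero σ i =>
    exact fun off Z I hM hZ => ⟨_, hZ.update i (r := Z 2 + Z 2) (by simp [hZ.zero]),
        Reaches.head_of_instr hM.head .refl⟩
  | @inc σ i =>
    exact fun off Z I hM hZ =>
      ⟨_, hZ.update i (r := Z (reg i) + Z 1) (by simp [hZ.one, hZ.reg]),
        Reaches.head_of_instr hM.head .refl⟩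
  | @dec σ i n h =>
    exact fun off Z I hM hZ =>
      ⟨_, hZ.update i (r := Z (reg i) - Z 1) (by simp [hZ.one, hZ.reg, h]),
        Reaches.head_of_instr hM.head .refl⟩
  | @move σ i j =>
    exact fun off Z I hM hZ =>
      ⟨_, hZ.update i (r := Z (reg j) + Z 2) (by simp [hZ.zero, hZ.reg]),
        Reaches.head_of_instr hM.head .refl⟩
  | seq _ _ hc hd =>
    intro off Z I hM hZ
    obtain ⟨Z₁, h1, h2⟩ := hc off Z I hM.left hZ
    obtain ⟨Z₂, h3, h4⟩ := hd _ Z₁ I hM.right h1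
    refine ⟨Z₂, h3, ?_⟩
    rw [Cmd.code, List.length_append, ← Nat.add_assoc]
    exact h2.trans h4
  | @loop_done c σ i h =>
    intro off Z I hM hZ
    refine ⟨Z, hZ, ?_⟩
    have := Reaches.of_instr (O := O) (c := ⟨off, Z, I⟩) hM.head
    simpa [Instr.exec, hZ.reg, h, Cmd.code, Nat.add_assoc] using this
  | @loop_step c σ τ ρ i h _ _ hc hl =>
    intro off Z I hM hZ
    obtain ⟨Z₁, h1, h2⟩ := hc _ Z I hM.tail.left hZ
    obtain ⟨Z₂, h3, h4⟩ := hl off Z₁ I hM h1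
    refine ⟨Z₂, h3, Reaches.head_of_instr hM.head ?_⟩
    have h5 := Reaches.of_instr (O := O)
      (c := ⟨off + 1 + (c.code (off + 1)).length, Z₁, I⟩) hM.tail.right.head
    simp only [Instr.exec, hZ.reg, Nat.cast_eq_zero, h, if_false]
    refine h2.trans (h5.trans ?_)
    -- The test that closes the loop body has equal targets and serves as a goto to the loop head.
    simp only [Instr.exec, ite_self]
    exact h4

/-! ### Semi-decision by equality tests -/

/-- The instructions that verify that the input is a natural number and copy it to `Z_3`. -/
def searchNat : Program :=
  -- Label `2` is a trap for inputs of length other than `1`. Labels `3` to `7` increase `Z_3` until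
  -- `Z_1 - Z_3 = 0`, with `Z_4` as scratch; label `8` then puts the constant `1` into `Z_1`.
  [.indexOne 2, .ifIndexEq 1 2 3 2, .ifIndexEq 1 1 2 2, .sub 4 1 3, .ifZero 4 8 5, .const 4 1,
    .add 3 3 4, .ifIndexEq 1 1 3 3, .const 1 1]

/-- A program that stops on the natural numbers for which `c` computes `0`. -/
def semiDecider (c : Cmd) : Program :=
  searchNat ++ (c.code 9 ++
    -- `Z_4` is `reg 1`, the result register of `c`; a nonzero result makes this instruction jump to
    -- itself forever.
    [.ifZero 4 (9 + (c.code 9).length + 1) (9 + (c.code 9).length)])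

theorem semiDecider_mem (c : Cmd) : semiDecider c ∈ MAddOneEq := by
  intro i hi
  rcases List.mem_append.1 hi with h | h
  · simp only [searchNat, List.mem_cons, List.not_mem_nil, or_false] at h
    rcases h with rfl | rfl | rfl | rfl | rfl | rfl | rfl | rfl | rfl <;>
      simp [Instr.IsAddOneEq]
  · rcases List.mem_append.1 h with h | h
    · exact c.isAddOneEq_of_mem_code 9 i h
    · simp only [List.mem_singleton] at h
      subst h
      trivial

theorem reaches_of_length_eq_one (c : Cmd) (a : ℝ) :
    Reaches (step ∅ (semiDecider c)) (init [a]) ⟨3, (init [a]).Z, fun _ => 1⟩ := by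
  refine Reaches.head_of_instr (i := .indexOne 2) rfl ?_
  refine Reaches.head_of_instr (i := .ifIndexEq 1 2 3 2) rfl ?_
  have hI : Function.update (init [a]).I 2 1 = fun _ => 1 := by
    funext i
    by_cases hi : i = 2 <;> simp [hi, init, Nat.toPNat', show Nat.succPNat 0 = 1 from rfl]
  simp only [Instr.exec, hI, if_true]
  exact .refl

theorem result_semiDecider_of_length_ne_one (c : Cmd) {x : List ℝ} (hx : x ∈ RInf)
    (h : x.length ≠ 1) : result ∅ (semiDecider c) x = Part.none := by
  have h1 : Reaches (step ∅ (semiDecider c)) (init x)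
      ⟨2, (init x).Z, Function.update (init x).I 2 1⟩ := by
    refine Reaches.head_of_instr (i := .indexOne 2) rfl ?_
    refine Reaches.head_of_instr (i := .ifIndexEq 1 2 3 2) rfl ?_
    have hne : (init x).I 1 ≠ 1 := by
      have hpos : 0 < x.length := List.length_pos_iff.2 hx
      simp only [init, ne_eq, ← PNat.coe_inj, Nat.toPNat'_coe, hpos, if_true]
      exact h
    simp only [Instr.exec, Function.update_self,
      Function.update_of_ne (show (1 : ℕ+) ≠ 2 by decide), hne, if_false]
    exact .refl
  refine result_eq_none_of_step_eq h1 ?_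
  rw [step_eq (i := .ifIndexEq 1 1 2 2) rfl]
  simp [Instr.exec]

theorem result_semiDecider_of_forall_ne (c : Cmd) {a : ℝ} (ha : ∀ n : ℕ, a ≠ n) :
    result ∅ (semiDecider c) [a] = Part.none := by
  refine result_eq_none (reaches_of_length_eq_one c a)
    -- The search loop as an invariant: `Z_4` is described only at the labels whose instruction
    -- reads it, and since `Z_3` is natural and `a` is not, the test at label `4` never exits.
    {d | d.Z 1 = a ∧ (∃ k : ℕ, d.Z 3 = k) ∧ (d.label = 3 ∨ (d.label = 4 ∧ d.Z 4 = a - d.Z 3) ∨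
      d.label = 5 ∨ (d.label = 6 ∧ d.Z 4 = 1) ∨ d.label = 7)} ?_ ?_
  · exact ⟨rfl, ⟨0, by simp [init]; rfl⟩, .inl rfl⟩
  · have h14 : (1 : ℕ+) ≠ 4 := by decide
    have h34 : (3 : ℕ+) ≠ 4 := by decide
    have h13 : (1 : ℕ+) ≠ 3 := by decide
    have h43 : (4 : ℕ+) ≠ 3 := by decide
    rintro ⟨l, Z, I⟩ ⟨h1, ⟨k, h3⟩, hl⟩
    simp only at h1 h3 hl
    rcases hl with rfl | ⟨rfl, h4⟩ | rfl | ⟨rfl, h4⟩ | rfl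
    · refine ⟨_, ?_, step_eq (i := .sub 4 1 3) rfl⟩
      simp [Instr.exec, h1, h3, h14, h34]
    · refine ⟨_, ?_, step_eq (i := .ifZero 4 8 5) rfl⟩
      have : a - k ≠ 0 := sub_ne_zero.2 (ha k)
      simp [Instr.exec, h1, h3, h4, this]
    · refine ⟨_, ?_, step_eq (i := .const 4 1) rfl⟩
      simp [Instr.exec, h1, h3, h14, h34]
    · refine ⟨_, ?_, step_eq (i := .add 3 3 4) rfl⟩
      simp only [Instr.exec, h3, h4, Set.mem_ofPred_eq, Function.update_of_ne h13, h1,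
        Function.update_self, true_and]
      exact ⟨⟨k + 1, by simp⟩, by simp⟩
    · refine ⟨_, ?_, step_eq (i := .ifIndexEq 1 1 3 3) rfl⟩
      simp [Instr.exec, h1, h3]

/-- Induction on the distance `d` from the counter to `n`. The registers other than `Z_1` and `Z_3`
end up zero, `Z_4` included as it holds the vanishing difference; this is the initial store for `c`.
-/
theorem exists_reaches_of_search (c : Cmd) (n d : ℕ) : ∀ (k : ℕ) (Z : ℕ+ → ℝ) (I : ℕ+ → ℕ+),
    k + d = n → Z 1 = n → Z 3 = k → (∀ i, i ≠ 1 → i ≠ 3 → i ≠ 4 → Z i = 0) →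
    ∃ Z', Reaches (step ∅ (semiDecider c)) ⟨3, Z, I⟩ ⟨8, Z', I⟩ ∧ Z' 3 = n ∧
      ∀ i, i ≠ 1 → i ≠ 3 → Z' i = 0 := by
  have h14 : (1 : ℕ+) ≠ 4 := by decide
  have h34 : (3 : ℕ+) ≠ 4 := by decide
  have h13 : (1 : ℕ+) ≠ 3 := by decide
  induction d with
  | zero =>
    intro k Z I hk h1 h3 h0
    obtain rfl : k = n := hk
    refine ⟨Function.update Z 4 (Z 1 - Z 3), ?_, ?_, fun i hi1 hi3 => ?_⟩
    · refine Reaches.head_of_instr (i := .sub 4 1 3) rfl ?_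
      refine Reaches.head_of_instr (i := .ifZero 4 8 5) rfl ?_
      simp only [Instr.exec, Function.update_self, h1, h3, sub_self, if_true]
      exact .refl
    · rw [Function.update_of_ne h34, h3]
    · by_cases hi4 : i = 4
      · simp [hi4, h1, h3]
      · rw [Function.update_of_ne hi4, h0 i hi1 hi3 hi4]
  | succ d ih =>
    intro k Z I hk h1 h3 h0
    have hkn : (n : ℝ) - k ≠ 0 := by
      rw [sub_ne_zero, Ne, Nat.cast_inj]
      omega
    obtain ⟨Z', hr, hZ'⟩ := ih (k + 1)
      (Function.update (Function.update (Function.update Z 4 (Z 1 - Z 3)) 4 1) 3 (Z 3 + 1)) I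
      (by omega) (by simp [h13, h14, h1]) (by simp [h3])
      (fun i hi1 hi3 hi4 => by simp [hi3, hi4, h0 i hi1 hi3 hi4])
    refine ⟨Z', ?_, hZ'⟩
    refine Reaches.head_of_instr (i := .sub 4 1 3) rfl ?_
    refine Reaches.head_of_instr (i := .ifZero 4 8 5) rfl ?_
    simp only [Instr.exec, Function.update_self, h1, h3, hkn, if_false]
    refine Reaches.head_of_instr (i := .const 4 1) rfl ?_
    refine Reaches.head_of_instr (i := .add 3 3 4) rfl ?_
    refine Reaches.head_of_instr (i := .ifIndexEq 1 1 3 3) rfl ?_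
    simpa [Instr.exec, h1, h3, h34] using hr

theorem exists_reaches_of_runs {c : Cmd} {n : ℕ} {τ : ℕ → ℕ}
    (h : Runs c (Function.update 0 0 n) τ) :
    ∃ Z, Holds τ Z ∧ Reaches (step ∅ (semiDecider c)) (init [(n : ℝ)])
      ⟨9 + (c.code 9).length, Z, fun _ => 1⟩ := by
  have h0 (i : ℕ+) (hi : i ≠ 1) : (init [(n : ℝ)]).Z i = 0 := by
    have : 1 ≤ i.natPred := by
      rw [Nat.one_le_iff_ne_zero]
      exact fun h => hi (PNat.natPred_injective h)
    simp only [init, List.getD_eq_getElem?_getD]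
    rw [List.getElem?_eq_none (by simpa using this), Option.getD_none]
  obtain ⟨Z, hr, h3, hZ⟩ := exists_reaches_of_search c n n 0 _ (fun _ => 1) (Nat.zero_add n)
    (show (init [(n : ℝ)]).Z 1 = n from rfl)
    (by rw [h0 3 (by decide), Nat.cast_zero]) (fun i hi _ _ => h0 i hi)
  -- Label `8` overwrites the input with `1`; its value survives in `Z_3 = reg 0`, the argument
  -- register of `c`.
  have hH : Holds (Function.update 0 0 n) (Function.update Z 1 1) := by
    refine ⟨Function.update_self .., ?_, fun i => ?_⟩
    · rw [Function.update_of_ne (by decide), hZ 2 (by decide) (by decide)]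
    · have hi1 : reg i ≠ 1 := by simp [reg, ← PNat.coe_inj]
      rw [Function.update_of_ne hi1]
      by_cases hi : i = 0
      · subst hi
        rw [show reg 0 = 3 from rfl, h3, Function.update_self]
      · have hi3 : reg i ≠ 3 := (reg_inj (j := 0)).not.2 hi
        simp [hZ _ hi1 hi3, hi]
  have hcode : CodeAt (semiDecider c) 9 (c.code 9) := fun i hi => by
    rw [semiDecider, List.getElem?_append_right (by simp [searchNat]),
      show 9 + i - searchNat.length = i by simp [searchNat], List.getElem?_append_left hi]
  obtain ⟨Z', hZ', hr'⟩ := h.reaches (O := ∅) 9 _ (fun _ => 1) hcode hH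
  refine ⟨Z', hZ', (reaches_of_length_eq_one c n).trans (hr.trans ?_)⟩
  exact Reaches.head_of_instr (i := .const 1 1) rfl hr'

/-- The while-program computes `0` on members and `1` on other naturals, so the final test stops
exactly on members. The output is then `[1]`, since `Z_1` still holds the constant `1` and `I_1 =
1`. -/
theorem addOneEqSemiDecidable_of_computablePred {P : Set (List ℝ)} (hP : P ⊆ NatSet)
    (h : ComputablePred fun n : ℕ => [(n : ℝ)] ∈ P) : AddOneEqSemiDecidable P := by
  classical
  obtain ⟨c, hc⟩ := exists_cmd_of_computable
    (f := fun n : ℕ => bif decide ([(n : ℝ)] ∈ P) then 0 else 1)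
    (Computable.cond h.decide (Computable.const 0) (Computable.const 1))
  refine ⟨semiDecider c, semiDecider_mem c, fun x hx => ?_⟩
  have hlast : (semiDecider c)[9 + (c.code 9).length]? =
      some (.ifZero 4 (9 + (c.code 9).length + 1) (9 + (c.code 9).length)) := by
    rw [semiDecider, List.getElem?_append_right (by simp [searchNat]),
      show 9 + (c.code 9).length - searchNat.length = (c.code 9).length by simp [searchNat],
      List.getElem?_concat_length]
  have hlen : (semiDecider c).length = 9 + (c.code 9).length + 1 := by
    simp [semiDecider, searchNat]
    omega
  have hnone (hxP : x ∉ P) : partialCharFun P x = Part.none := Part.eq_none_iff'.2 hxP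
  by_cases hxN : x ∈ NatSet
  · obtain ⟨n, rfl⟩ := hxN
    obtain ⟨τ, hτ, h1⟩ := hc (Function.update 0 0 n)
    rw [Function.update_self] at h1
    obtain ⟨Z, hZ, hr⟩ := exists_reaches_of_runs hτ
    have h4 : Z 4 = (τ 1 : ℝ) := hZ.reg 1
    rw [h1] at h4
    by_cases hn : [(n : ℝ)] ∈ P
    · have hr' := hr.trans (Reaches.of_instr hlast)
      simp only [hn, decide_true, cond_true, Nat.cast_zero] at h4
      simp only [Instr.exec, h4, if_true] at hr'
      rw [result_eq_some hr' (by simp [step, hlen])]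
      refine Part.ext fun y => ?_
      simp [partialCharFun, hn, Config.tuple, show Nat.succPNat 0 = 1 from rfl, hZ.one, eq_comm]
    · rw [hnone hn]
      simp only [hn, decide_false, cond_false, Nat.cast_one] at h4
      refine result_eq_none_of_step_eq hr ?_
      rw [step_eq hlast]
      simp [Instr.exec, h4]
  · rw [hnone fun h => hxN (hP h)]
    by_cases hl : x.length = 1
    · obtain ⟨a, rfl⟩ := List.length_eq_one_iff.1 hl
      exact result_semiDecider_of_forall_ne c fun n ha => hxN ⟨n, by rw [ha]⟩
    · exact result_semiDecider_of_length_ne_one c hx hl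

/-! ### From reducibility to classical decidability, and the conclusion -/

/-- A set of natural numbers that is strongly Turing reducible to a set that is decidable on the
integers is classically decidable. -/
theorem computablePred_of_strongTuringReducible {P Q : Set (List ℝ)} (hQ : Q ⊆ RInf)
    (hQdec : AddOneDecidableOnIntegers Q) (h : StrongTuringReducible P Q) :
    ComputablePred fun n : ℕ => [(n : ℝ)] ∈ P := by
  obtain ⟨N, hN, hNdec⟩ := hQdec
  obtain ⟨M, hM, hMdec⟩ := h
  have hN' : N ∈ MAddOneOracle := fun i hi => by
    have := hN i hi
    cases i <;> first | exact this | trivial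
  -- The decider of `Q ∩ ZInf` runs with the empty oracle, which the constant `false` represents.
  obtain ⟨f, hf, hfQ⟩ := exists_computable_of_decides (O := fun _ => false)
    (Computable.const false) (by simp) hN' hNdec
  -- The function `f` decides `Q ∩ ZInf`, yet it serves as oracle for `Q`: a tuple of differences of
  -- naturals has integer entries.
  obtain ⟨g, hg, hgP⟩ := exists_computable_of_decides hf (B := Q) (fun x hx => by
    rw [hfQ x hx]
    refine ⟨fun h => h.1, fun h => ⟨h, hQ h, fun a ha => ?_⟩⟩
    obtain ⟨p, -, rfl⟩ := List.mem_map.1 ha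
    exact ⟨(p.1 : ℤ) - p.2, by simp [diff]⟩) hM hMdec
  refine ComputablePred.computable_iff.2 ⟨fun n => g [(n, 0)], hg.comp ?_, ?_⟩
  · exact (Primrec.list_cons.comp (Primrec.id.pair (Primrec.const 0)) (Primrec.const [])).to_comp
  · funext n
    rw [hgP _ (by simp)]
    simp [diff]

end AddBSS

theorem mainTheorem5 (Q P : Set (List ℝ)) (hQ : Q ⊆ AddBSS.RInf)
    (hQdec : AddBSS.AddOneDecidableOnIntegers Q)
    (hP : P ⊆ AddBSS.NatSet)
    (h : ¬ AddBSS.AddOneEqSemiDecidable P ∨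
      ¬ AddBSS.AddOneEqSemiDecidable ((AddBSS.RInf \ P) ∩ AddBSS.NatSet)) :
    ¬ AddBSS.StrongTuringReducible P Q := by
  intro hPQ
  have hc := AddBSS.computablePred_of_strongTuringReducible hQ hQdec hPQ
  refine h.elim (fun h => h (AddBSS.addOneEqSemiDecidable_of_computablePred hP hc)) fun h => h ?_
  -- On naturals, membership in this set is the negation of membership in `P`, and computable
  -- predicates are closed under negation.
  refine AddBSS.addOneEqSemiDecidable_of_computablePred Set.inter_subset_right
    (hc.not.of_eq fun n => ?_)
  simp [AddBSS.RInf, AddBSS.NatSet]
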